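/- Let $V$ be a finite-dimensional real vector space of dimension $r$ with inner product $\langle\cdot,\cdot\rangle$, and let $\Delta\subset V$ be a finite reduced crystallographic root system (not necessarily irreducible), with coroots $\alpha^\vee=2\alpha/\langle\alpha,\alpha\rangle$, fundamental system $\Psi=\{\alpha_1,\dots,\alpha_r\}$, positive roots $\Delta_+$, and coroot lattice $Q^\vee=\bigoplus_{i=1}^r\mathbb{Z}\,\alpha_i^\vee$. Let $\lambda_1,\dots,\lambda_r\in V$ be the fundamental weights, defined by $\langle\alpha_i^\vee,\lambda_j\rangle=\delta_{ij}$. Write $B_k(x)$ for the Bernoulli polynomials and $\{x\}$ for the fractional part of a real number $x$. For $\mathbf{k}=(k_\alpha)_{\alpha\in\Delta_+}$ with $k_\alpha\in\mathbb{Z}_{\ge 0}$ and $\mathbf{y}\in V$ put $$P(\mathbf{k},\mathbf{y};\Delta)=\int_{[0,1]^{\Delta_+\setminus\Psi}}\Bigl(\prod_{\alpha\in\Delta_+\setminus\Psi}B_{k_\alpha}(x_\alpha)\Bigr)\prod_{i=1}^r B_{k_{\alpha_i}}\Bigl(\Bigl\{\langle\mathbf{y},\lambda_i\rangle-\sum_{\alpha\in\Delta_+\setminus\Psi}x_\alpha\langle\alpha^\vee,\lambda_i\rangle\Bigr\}\Bigr)\prod_{\alpha\in\Delta_+\setminus\Psi}dx_\alpha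 .$$ Let $\mathfrak{H}_{\mathscr{R}}\subset V$ be the union of all affine hyperplanes $q+\bigoplus_{\beta\in\mathbf{R}}\mathbb{R}\,\beta^\vee$, where $q\in Q^\vee$ and $\mathbf{R}$ runs over the linearly independent subsets of $\Delta$ with $r-1$ elements. Theorem. Fix $\mathbf{k}$. If the function $\mathbf{y}\mapsto P(\mathbf{k},\mathbf{y};\Delta)$ is not constant on $V$, then it is not real analytic on $V$; moreover there is a point of $\mathfrak{H}_{\mathscr{R}}$ at which it is not real analytic. -/

import Mathlib

open MeasureTheory

noncomputable section

namespace RootBernoulli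

variable {ι V : Type*} [NormedAddCommGroup V] [InnerProductSpace ℝ V] [FiniteDimensional ℝ V]
  {P : RootPairing ι ℝ V V}

/-- The fundamental weights `λ_i ∈ V`: the basis of `V` dual, for the inner product, to the basis
of simple coroots. -/
def fundamentalWeight [P.IsRootSystem] (b : P.Base) (i : b.support) : V :=
  (InnerProductSpace.toDual ℝ V).symm (LinearMap.toContinuousLinearMap (b.toCoweightBasis.coord i))

open Classical in
/-- The defining property `⟨α_j^∨, λ_i⟩ = δ_{ij}` of the fundamental weights. -/
theorem inner_coroot_fundamentalWeight [P.IsRootSystem] (b : P.Base) (i j : b.support) :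
    inner ℝ (P.coroot j) (fundamentalWeight b i) = if i = j then 1 else 0 := by
  rw [real_inner_comm, fundamentalWeight, InnerProductSpace.toDual_symm_apply,
    ← b.toCoweightBasis_apply j]
  simp [Finsupp.single_apply, eq_comm, -RootPairing.Base.toCoweightBasis_apply]

/-- The (indices of the) positive roots `Δ₊`. -/
abbrev PosRoot (b : P.Base) : Type _ := {α : ι // b.IsPos α}

/-- The (indices of the) positive roots that are not simple, `Δ₊ \ Ψ`. -/
abbrev NonSimplePosRoot (b : P.Base) : Type _ := {α : ι // b.IsPos α ∧ α ∉ b.support}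

open Classical in
/-- The Bernoulli periodic function `P(k, y; Δ)` of the root system: the integral over the cube
`[0,1]^(Δ₊ \ Ψ)` of
`∏_{α ∈ Δ₊ \ Ψ} B_{k_α}(x_α) * ∏_i B_{k_{α_i}}({⟨y, λ_i⟩ - ∑_α x_α ⟨α^∨, λ_i⟩})`,
where `{·}` is the fractional part. -/
def bernoulliPeriodic [Fintype ι] [P.IsRootSystem] (b : P.Base) (k : PosRoot b → ℕ) (y : V) : ℝ :=
  ∫ x in Set.univ.pi fun _ : NonSimplePosRoot b ↦ Set.Icc (0 : ℝ) 1,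
    (∏ α : NonSimplePosRoot b, bernoulliFun (k ⟨α.1, α.2.1⟩) (x α)) *
      ∏ i : b.support, bernoulliFun (k ⟨i.1, RootPairing.Base.isPos_of_mem_support i.2⟩)
        (Int.fract (inner ℝ y (fundamentalWeight b i) -
          ∑ α : NonSimplePosRoot b, x α * inner ℝ (P.coroot α.1) (fundamentalWeight b i)))

/-- The coroot lattice `Q^∨`, the `ℤ`-span of the simple coroots. -/
def corootLattice (b : P.Base) : Submodule ℤ V := Submodule.span ℤ (P.coroot '' b.support)

/-- The union `𝔥_ℛ` of all the affine hyperplanes `q + ⨁_{β ∈ R} ℝ β^∨`, for `q ∈ Q^∨` and `R` a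
linearly independent set of `dim V - 1` roots. -/
def singularHyperplanes (b : P.Base) : Set V :=
  {y | ∃ R : Finset ι, R.card + 1 = Module.finrank ℝ V ∧ LinearIndepOn ℝ P.root (R : Set ι) ∧
    ∃ q ∈ corootLattice b, y - q ∈ Submodule.span ℝ (P.coroot '' (R : Set ι))}

end RootBernoulli

end

/-! The function `P(k, ·; Δ)` is a weighted average of a product of polynomials in the fractional
parts of the simple-coroot coordinates. The average runs over translates by the zonotope spanned by
the non-simple positive coroots. The function is periodic under the simple coroots.

Outside the hyperplanes it is locally polynomial. On a bounded region the product of fractional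
parts is a cone spline: a sum of polynomials cut off to simplicial cones with coroot edges and apex
in `Q^∨`. Up to null sets, this class is stable under averaging along a coroot `w`
(`segmentConv_coneFun`). Integrating the one-variable integrand by parts (`integral_mul_prod_step`),
the endpoints give cones with apex `q` or `q + w`, and each jump gives cones in which one edge is
replaced by `w`. Iterating over the non-simple positive coroots (`boxConv_mem`) gives a cone spline
equal to `P` almost everywhere near a given point. Its walls lie in the singular hyperplanes, since
such a wall is spanned by `r - 1` independent coroots. Off the walls `P` is continuous, so equality
holds at every nearby point.

If `P` were analytic at every point of the hyperplanes, it would be analytic on `V`. By the identity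
theorem it would then be a single polynomial, and a polynomial invariant under a basis of
translations is constant. -/

open MeasureTheory

noncomputable section

namespace RootBernoulli

open Set Filter Topology Polynomial

/-! ### Polynomial functions on a normed space, and their periods. -/

section PolynomialFunctions

variable {E : Type*} [NormedAddCommGroup E] [NormedSpace ℝ E]

variable (E) in
/-- The algebra of polynomial functions on a normed space, generated by the continuous linear
functionals. -/
def polyFun : Subalgebra ℝ (E → ℝ) := Algebra.adjoin ℝ {f | ∃ L : E →L[ℝ] ℝ, f = L}

theorem polyFun_clm (L : E →L[ℝ] ℝ) : (L : E → ℝ) ∈ polyFun E :=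
  Algebra.subset_adjoin ⟨L, rfl⟩

theorem polyFun_const (c : ℝ) : (fun _ : E ↦ c) ∈ polyFun E :=
  (polyFun E).algebraMap_mem c

theorem polyFun_eval {u : E → ℝ} (hu : u ∈ polyFun E) (p : ℝ[X]) :
    (fun y ↦ p.eval (u y)) ∈ polyFun E := by
  induction p using Polynomial.induction_on' with
  | add p q hp hq => simpa [Pi.add_def] using (polyFun E).add_mem hp hq
  | monomial n a =>
    simpa [Pi.mul_def, Pi.pow_def] using
      (polyFun E).mul_mem (polyFun_const a) ((polyFun E).pow_mem hu n)

theorem analyticAt_of_mem_polyFun {p : E → ℝ} (hp : p ∈ polyFun E) (y : E) :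
    AnalyticAt ℝ p y := by
  induction hp using Algebra.adjoin_induction with
  | mem f hf => obtain ⟨L, rfl⟩ := hf; exact L.analyticAt y
  | algebraMap r => exact analyticAt_const
  | add f g _ _ hf hg => exact hf.add hg
  | mul f g _ _ hf hg => exact hf.mul hg

theorem continuous_of_mem_polyFun {p : E → ℝ} (hp : p ∈ polyFun E) : Continuous p :=
  continuous_iff_continuousAt.2 fun y ↦ (analyticAt_of_mem_polyFun hp y).continuousAt

/-- Evaluation of polynomial functions at a point. -/
def evalAt (y : E) : polyFun E →+* ℝ := (Pi.evalRingHom (fun _ : E ↦ ℝ) y).comp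
  (polyFun E).val.toRingHom

@[simp] theorem evalAt_apply (y : E) (p : polyFun E) : evalAt y p = (p : E → ℝ) y := rfl

/-- Along a line, a polynomial function is a polynomial of the line parameter whose coefficients
are polynomial functions of the base point. -/
theorem exists_polynomial_along_line {p : E → ℝ} (hp : p ∈ polyFun E) (w : E) :
    ∃ Q : (polyFun E)[X], ∀ (y : E) (x : ℝ), p (y - x • w) = (Q.map (evalAt y)).eval x := by
  induction hp using Algebra.adjoin_induction with
  | mem f hf =>
    obtain ⟨L, rfl⟩ := hf
    refine ⟨C ⟨_, polyFun_clm L⟩ - C ⟨_, polyFun_const (L w)⟩ * X, fun y x ↦ ?_⟩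
    simp only [Polynomial.map_sub, Polynomial.map_mul, map_C, map_X, evalAt_apply, eval_sub,
      eval_mul, eval_C, eval_X, map_sub, map_smul, smul_eq_mul, mul_comm]
  | algebraMap r =>
    exact ⟨C ⟨_, polyFun_const r⟩, fun y x ↦ by simp⟩
  | add f g _ _ hf hg =>
    obtain ⟨F, hF⟩ := hf
    obtain ⟨G, hG⟩ := hg
    exact ⟨F + G, fun y x ↦ by simp [hF, hG]⟩
  | mul f g _ _ hf hg =>
    obtain ⟨F, hF⟩ := hf
    obtain ⟨G, hG⟩ := hg
    exact ⟨F * G, fun y x ↦ by simp [hF, hG]⟩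

/-- Antiderivatives are needed with coefficients in `polyFun E`, so that integrating along a line
keeps polynomial dependence on the base point. -/
theorem _root_.Polynomial.exists_derivative_eq {A : Type*} [CommRing A] [Algebra ℝ A]
    (Q : A[X]) : ∃ R : A[X], derivative R = Q := by
  induction Q using Polynomial.induction_on' with
  | add p q hp hq =>
    obtain ⟨F, hF⟩ := hp
    obtain ⟨G, hG⟩ := hq
    exact ⟨F + G, by simp [hF, hG]⟩
  | monomial n a =>
    refine ⟨monomial (n + 1) (((n + 1 : ℝ)⁻¹) • a), ?_⟩
    have h : ((n : A) + 1) = algebraMap ℝ A (n + 1) := by simp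
    rw [derivative_monomial]
    simp only [Nat.add_sub_cancel, Nat.cast_add, Nat.cast_one]
    rw [h, mul_comm, ← Algebra.smul_def, smul_smul, mul_inv_cancel₀ (by positivity), one_smul]

/-- Evaluating `R` at `u` inside the ring `polyFun E` and then at `y` is the same as doing both at
once. -/
theorem polyFun_eval_map (R : (polyFun E)[X]) {u : E → ℝ} (hu : u ∈ polyFun E) :
    (fun y ↦ (R.map (evalAt y)).eval (u y)) ∈ polyFun E := by
  have : (fun y ↦ (R.map (evalAt y)).eval (u y)) = (R.eval ⟨u, hu⟩ : polyFun E) := by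
    ext y
    rw [eval_map, ← evalAt_apply, ← eval₂_at_apply]
    rfl
  rw [this]
  exact SetLike.coe_mem _

/-- Restricted to a line in direction `v`, the polynomial takes the value `p y` at every natural
parameter, hence at infinitely many points. -/
theorem constant_along_period {p : E → ℝ} (hp : p ∈ polyFun E) {v : E}
    (hv : ∀ y, p (y + v) = p y) (y : E) (x : ℝ) : p (y + x • v) = p y := by
  obtain ⟨Q, hQ⟩ := exists_polynomial_along_line hp (-v)
  have hn : ∀ n : ℕ, p (y + (n : ℝ) • v) = p y := by
    intro n
    induction n with
    | zero => simp
    | succ n ih => rw [← ih, ← hv (y + (n : ℝ) • v)]; congr 1; push_cast; module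
  have h : Q.map (evalAt y) = C (p y) := by
    refine eq_of_infinite_eval_eq _ _ ((infinite_range_of_injective
      (Nat.cast_injective (R := ℝ))).mono ?_)
    rintro _ ⟨n, rfl⟩
    have := hQ y n
    rw [smul_neg, sub_neg_eq_add, hn] at this
    simp [← this]
  have := hQ y x
  rw [smul_neg, sub_neg_eq_add, h, eval_C] at this
  exact this

end PolynomialFunctions

/-! ### Integration by parts against products of step functions. -/

section Jumps

/-- The indicator function of `[0, ∞)`. -/
def step (t : ℝ) : ℝ := if 0 ≤ t then 1 else 0

theorem step_of_nonneg {t : ℝ} (h : 0 ≤ t) : step t = 1 := if_pos h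

theorem step_of_neg {t : ℝ} (h : t < 0) : step t = 0 := if_neg h.not_ge

theorem measurable_step : Measurable step :=
  Measurable.ite measurableSet_Ici measurable_const measurable_const

theorem abs_step_le (t : ℝ) : |step t| ≤ 1 := by
  unfold step; split_ifs <;> simp

theorem abs_prod_step_le {I : Type*} (s : Finset I) (z : I → ℝ) : |∏ i ∈ s, step (z i)| ≤ 1 := by
  rw [Finset.abs_prod]
  exact Finset.prod_le_one (fun _ _ ↦ abs_nonneg _) fun i _ ↦ abs_step_le _

theorem eventually_step_eq {t : ℝ} (h : t ≠ 0) : ∀ᶠ s in 𝓝 t, step s = step t := by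
  rcases h.lt_or_gt with h | h
  · filter_upwards [gt_mem_nhds h] with s hs
    rw [step_of_neg hs, step_of_neg h]
  · filter_upwards [lt_mem_nhds h] with s hs
    rw [step_of_nonneg hs.le, step_of_nonneg h.le]

theorem intervalIntegrable_mul_prod_step {r : ℝ → ℝ} (hr : Continuous r) {I : Type*}
    (s : Finset I) (z c : I → ℝ) (a b : ℝ) :
    IntervalIntegrable (fun x ↦ r x * ∏ i ∈ s, step (z i - c i * x)) volume a b := by
  have hm : Measurable fun x : ℝ ↦ ∏ i ∈ s, step (z i - c i * x) :=
    Finset.measurable_fun_prod _ fun i _ ↦ measurable_step.comp (by fun_prop)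
  exact ⟨(hr.intervalIntegrable a b).1.mul_bdd hm.aestronglyMeasurable
    (ae_of_all _ fun x ↦ abs_prod_step_le _ _),
    (hr.intervalIntegrable a b).2.mul_bdd hm.aestronglyMeasurable
    (ae_of_all _ fun x ↦ abs_prod_step_le _ _)⟩

open Classical in
/-- The contributions of the jumps of a product of step functions to the integral of `R'` against
this product. -/
def jumpSum {I : Type*} (R : ℝ → ℝ) (z c : I → ℝ) (a b : ℝ) (s : Finset I) : ℝ :=
  ∑ i ∈ s, if c i ≠ 0 ∧ a < z i / c i ∧ z i / c i < b then
    SignType.sign (c i) * R (z i / c i) * ∏ j ∈ s.erase i, step (z j - c j * (z i / c i)) else 0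

open Classical in
theorem jumpSum_insert {I : Type*} (R : ℝ → ℝ) (z c : I → ℝ) (a b : ℝ) (s : Finset I) {k : I}
    (hk : k ∉ s) :
    jumpSum R z c a b (insert k s) =
      (if c k ≠ 0 ∧ a < z k / c k ∧ z k / c k < b then
        SignType.sign (c k) * R (z k / c k) * ∏ j ∈ s, step (z j - c j * (z k / c k)) else 0) +
      ∑ i ∈ s, if c i ≠ 0 ∧ a < z i / c i ∧ z i / c i < b then
        SignType.sign (c i) * R (z i / c i) * (step (z k - c k * (z i / c i)) *
          ∏ j ∈ s.erase i, step (z j - c j * (z i / c i))) else 0 := by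
  rw [jumpSum, Finset.sum_insert hk, Finset.erase_insert hk]
  congr 1
  refine Finset.sum_congr rfl fun i hi ↦ ?_
  have : i ≠ k := fun h ↦ hk (h ▸ hi)
  rw [Finset.erase_insert_of_ne this.symm, Finset.prod_insert (by simp [hk])]

/-- Integration by parts against a product of step functions with distinct jumps. -/
theorem integral_mul_prod_step {R r : ℝ → ℝ} (hR : ∀ x, HasDerivAt R (r x) x)
    (hr : Continuous r) {I : Type*} (z c : I → ℝ) (s : Finset I)
    (hinj : ∀ i ∈ s, ∀ j ∈ s, c i ≠ 0 → c j ≠ 0 → z i / c i = z j / c j → i = j)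
    (a b : ℝ) (hab : a ≤ b) (hne : ∀ i ∈ s, c i ≠ 0 → z i / c i ≠ a ∧ z i / c i ≠ b) :
    ∫ x in a..b, r x * ∏ i ∈ s, step (z i - c i * x) =
      R b * ∏ i ∈ s, step (z i - c i * b) - R a * ∏ i ∈ s, step (z i - c i * a) +
        jumpSum R z c a b s := by
  classical
  induction s using Finset.induction_on generalizing a b with
  | empty =>
    simp only [Finset.prod_empty, mul_one, jumpSum, Finset.sum_empty, add_zero]
    exact intervalIntegral.integral_eq_sub_of_hasDerivAt (fun x _ ↦ hR x)
      (hr.intervalIntegrable _ _)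
  | insert k s hk ih =>
    have hinj' : ∀ i ∈ s, ∀ j ∈ s, c i ≠ 0 → c j ≠ 0 → z i / c i = z j / c j → i = j :=
      fun i hi j hj ↦ hinj i (by simp [hi]) j (by simp [hj])
    have hnes : ∀ i ∈ s, c i ≠ 0 → z i / c i ≠ a ∧ z i / c i ≠ b :=
      fun i hi ↦ hne i (by simp [hi])
    -- On an interval in whose interior the `k`-th step is constant, it factors out and the
    -- induction hypothesis applies.
    have key : ∀ (a' b' v : ℝ), a' ≤ b' →
        (∀ i ∈ s, c i ≠ 0 → z i / c i ≠ a' ∧ z i / c i ≠ b') →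
        (∀ x ∈ Ioo a' b', step (z k - c k * x) = v) →
        ∫ x in a'..b', r x * ∏ i ∈ insert k s, step (z i - c i * x) =
          v * (R b' * ∏ i ∈ s, step (z i - c i * b') - R a' * ∏ i ∈ s, step (z i - c i * a') +
            jumpSum R z c a' b' s) := by
      intro a' b' v hab' hne' hv
      rw [← ih hinj' a' b' hab' hne', ← intervalIntegral.integral_const_mul,
        intervalIntegral.integral_of_le hab', intervalIntegral.integral_of_le hab',
        integral_Ioc_eq_integral_Ioo, integral_Ioc_eq_integral_Ioo]
      refine setIntegral_congr_fun measurableSet_Ioo fun x hx ↦ ?_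
      rw [Finset.prod_insert hk, hv x hx]
      ring
    rw [jumpSum_insert _ _ _ _ _ _ hk, Finset.prod_insert hk, Finset.prod_insert hk]
    -- If the `k`-th jump is interior, the interval is cut there. Only one half survives, and its
    -- new endpoint term is the jump contribution of `k`, with sign given by `c k`.
    by_cases hc : c k ≠ 0 ∧ a < z k / c k ∧ z k / c k < b
    · obtain ⟨hc0, hua, hub⟩ := hc
      have hsplit := intervalIntegral.integral_add_adjacent_intervals
        (intervalIntegrable_mul_prod_step hr (insert k s) z c a (z k / c k))
        (intervalIntegrable_mul_prod_step hr (insert k s) z c (z k / c k) b)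
      have hneu : ∀ i ∈ s, c i ≠ 0 → z i / c i ≠ z k / c k := by
        intro i hi hci h
        exact hk (hinj i (by simp [hi]) k (by simp) hci hc0 h ▸ hi)
      have hz : z k = c k * (z k / c k) := by field_simp
      set u := z k / c k with hu
      rw [if_pos ⟨hc0, hua, hub⟩, ← hsplit]
      rcases hc0.lt_or_gt with hneg | hpos
      · have hsub : ∀ x, x < u → step (z k - c k * x) = 0 := fun x hx ↦
          step_of_neg (by rw [hz]; nlinarith)
        have hsup : ∀ x, u ≤ x → step (z k - c k * x) = 1 := fun x hx ↦
          step_of_nonneg (by rw [hz]; nlinarith)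
        rw [key a u 0 hua.le (fun i hi hci ↦ ⟨(hnes i hi hci).1, hneu i hi hci⟩)
          (fun x hx ↦ hsub x hx.2), key u b 1 hub.le
          (fun i hi hci ↦ ⟨hneu i hi hci, (hnes i hi hci).2⟩) (fun x hx ↦ hsup x hx.1.le),
          hsub a hua, hsup b hub.le, sign_neg hneg]
        have : jumpSum R z c u b s = ∑ i ∈ s, if c i ≠ 0 ∧ a < z i / c i ∧ z i / c i < b then
            SignType.sign (c i) * R (z i / c i) * (step (z k - c k * (z i / c i)) *
            ∏ j ∈ s.erase i, step (z j - c j * (z i / c i))) else 0 := by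
          refine Finset.sum_congr rfl fun i hi ↦ ?_
          by_cases hci : c i = 0
          · simp [hci]
          rcases (hneu i hi hci).lt_or_gt with h | h
          · rw [if_neg (by grind), hsub _ h]; simp
          · rw [hsup _ h.le, one_mul]
            exact if_congr (by grind) rfl rfl
        rw [this]
        simp only [SignType.coe_neg_one]
        ring
      · have hsub : ∀ x, x ≤ u → step (z k - c k * x) = 1 := fun x hx ↦
          step_of_nonneg (by rw [hz]; nlinarith)
        have hsup : ∀ x, u < x → step (z k - c k * x) = 0 := fun x hx ↦
          step_of_neg (by rw [hz]; nlinarith)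
        rw [key a u 1 hua.le (fun i hi hci ↦ ⟨(hnes i hi hci).1, hneu i hi hci⟩)
          (fun x hx ↦ hsub x hx.2.le), key u b 0 hub.le
          (fun i hi hci ↦ ⟨hneu i hi hci, (hnes i hi hci).2⟩) (fun x hx ↦ hsup x hx.1),
          hsub a hua.le, hsup b hub, sign_pos hpos]
        have : jumpSum R z c a u s = ∑ i ∈ s, if c i ≠ 0 ∧ a < z i / c i ∧ z i / c i < b then
            SignType.sign (c i) * R (z i / c i) * (step (z k - c k * (z i / c i)) *
            ∏ j ∈ s.erase i, step (z j - c j * (z i / c i))) else 0 := by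
          refine Finset.sum_congr rfl fun i hi ↦ ?_
          by_cases hci : c i = 0
          · simp [hci]
          rcases (hneu i hi hci).lt_or_gt with h | h
          · rw [hsub _ h.le, one_mul]
            exact if_congr (by grind) rfl rfl
          · rw [if_neg (by grind), hsup _ h]; simp
        rw [this]
        simp only [SignType.coe_one]
        ring
    · rw [if_neg hc, zero_add]
      obtain ⟨v, hv⟩ : ∃ v, ∀ x ∈ Icc a b, step (z k - c k * x) = v := by
        by_cases hc0 : c k = 0
        · exact ⟨step (z k), fun x _ ↦ by simp [hc0]⟩
        have hz : z k = c k * (z k / c k) := by field_simp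
        obtain ⟨h1, h2⟩ := hne k (by simp) hc0
        set u := z k / c k with hu
        have hcases : u < a ∨ b < u := by grind
        rcases hcases with h | h <;> rcases lt_or_gt_of_ne hc0 with h' | h'
        · exact ⟨1, fun x hx ↦ step_of_nonneg (by rw [hz]; nlinarith [hx.1])⟩
        · exact ⟨0, fun x hx ↦ step_of_neg (by rw [hz]; nlinarith [hx.1])⟩
        · exact ⟨0, fun x hx ↦ step_of_neg (by rw [hz]; nlinarith [hx.2])⟩
        · exact ⟨1, fun x hx ↦ step_of_nonneg (by rw [hz]; nlinarith [hx.2])⟩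
      rw [key a b v hab hnes fun x hx ↦ hv x ⟨hx.1.le, hx.2.le⟩, hv a ⟨le_rfl, hab⟩,
        hv b ⟨hab, le_rfl⟩, mul_add, jumpSum, Finset.mul_sum]
      congr 1
      · ring
      · refine Finset.sum_congr rfl fun i hi ↦ ?_
        split_ifs with h
        · rw [hv _ ⟨h.2.1.le, h.2.2.le⟩]
          ring
        · simp

end Jumps

/-! ### Cone splines and their stability under averaging along a segment. -/

section ConeSplines

variable {E : Type*} [NormedAddCommGroup E] [NormedSpace ℝ E] {I : Type*}

/-- The families `e` and `ℓ` are dual to each other. -/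
def IsDualSystem (e : I → E) (ℓ : I → E →L[ℝ] ℝ) : Prop :=
  (∀ i, ℓ i (e i) = 1) ∧ ∀ i j, i ≠ j → ℓ i (e j) = 0

open Classical in
/-- The functionals dual to the family obtained from `e` on replacing `e i` by `w`. -/
def exchangeDual (ℓ : I → E →L[ℝ] ℝ) (w : E) (i : I) : I → E →L[ℝ] ℝ :=
  Function.update (fun j ↦ ℓ j - (ℓ j w / ℓ i w) • ℓ i) i ((ℓ i w)⁻¹ • ℓ i)

-- A basis exchange: the replacement of `e i` by `w` is allowed because `w` has a nonzero `i`-th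
-- coordinate.
open Classical in
theorem IsDualSystem.exchange {e : I → E} {ℓ : I → E →L[ℝ] ℝ} (h : IsDualSystem e ℓ) {w : E}
    {i : I} (hw : ℓ i w ≠ 0) : IsDualSystem (Function.update e i w) (exchangeDual ℓ w i) := by
  refine ⟨fun j ↦ ?_, fun j k hjk ↦ ?_⟩
  · by_cases hj : j = i
    · subst hj; simp [exchangeDual, hw]
    · simp [exchangeDual, hj, h.1, h.2 i j (Ne.symm hj)]
  · by_cases hj : j = i
    · subst hj
      simp [exchangeDual, Ne.symm hjk, h.2 j k hjk]
    · by_cases hk : k = i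
      · subst hk; simp [exchangeDual, hj, hw]
      · simp [exchangeDual, hj, hk, h.2 j k hjk, h.2 i k (Ne.symm hk)]

variable [Fintype I]

/-- The product of a polynomial function and of the indicator function of the cone with apex `q`
cut out by the functionals `ℓ i`. -/
def coneFun (p : E → ℝ) (ℓ : I → E →L[ℝ] ℝ) (q : E) (y : E) : ℝ :=
  p y * ∏ i, step (ℓ i (y - q))

variable (I) in
/-- The span of the polynomial functions cut off to simplicial cones with edges in `A` and apex in
`Λ`. -/
def coneSplines (A : Set E) (Λ : Submodule ℤ E) : Submodule ℝ (E → ℝ) :=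
  Submodule.span ℝ {f | ∃ (e : I → E) (ℓ : I → E →L[ℝ] ℝ), IsDualSystem e ℓ ∧ (∀ i, e i ∈ A) ∧
    ∃ q ∈ Λ, ∃ p ∈ polyFun E, f = coneFun p ℓ q}

variable {A : Set E} {Λ : Submodule ℤ E}

theorem coneFun_mem {e : I → E} {ℓ : I → E →L[ℝ] ℝ} (h : IsDualSystem e ℓ) (hA : ∀ i, e i ∈ A)
    {q : E} (hq : q ∈ Λ) {p : E → ℝ} (hp : p ∈ polyFun E) :
    coneFun p ℓ q ∈ coneSplines I A Λ :=
  Submodule.subset_span ⟨e, ℓ, h, hA, q, hq, p, hp, rfl⟩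

/-- Measurable functions that are bounded on compact sets. -/
def IsTame [MeasurableSpace E] (f : E → ℝ) : Prop :=
  Measurable f ∧ ∀ K, IsCompact K → ∃ C, ∀ y ∈ K, |f y| ≤ C

theorem isTame_coneFun [MeasurableSpace E] [BorelSpace E] {p : E → ℝ} (hp : p ∈ polyFun E)
    (ℓ : I → E →L[ℝ] ℝ) (q : E) : IsTame (coneFun p ℓ q) := by
  have hc := continuous_of_mem_polyFun hp
  refine ⟨hc.measurable.mul (Finset.measurable_fun_prod _ fun i _ ↦ measurable_step.comp
    (by fun_prop)), fun K hK ↦ ?_⟩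
  obtain ⟨C, hC⟩ := hK.exists_bound_of_continuousOn hc.continuousOn
  refine ⟨C, fun y hy ↦ ?_⟩
  rw [coneFun, abs_mul]
  exact (mul_le_of_le_one_right (abs_nonneg _) (abs_prod_step_le _ _)).trans (hC y hy)

theorem isTame_of_mem_coneSplines [MeasurableSpace E] [BorelSpace E] {f : E → ℝ}
    (hf : f ∈ coneSplines I A Λ) : IsTame f := by
  induction hf using Submodule.span_induction with
  | mem f hf =>
    obtain ⟨e, ℓ, -, -, q, -, p, hp, rfl⟩ := hf
    exact isTame_coneFun hp ℓ q
  | zero => exact ⟨measurable_const, fun K _ ↦ ⟨0, by simp⟩⟩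
  | add f g _ _ hf hg =>
    refine ⟨hf.1.add hg.1, fun K hK ↦ ?_⟩
    obtain ⟨C, hC⟩ := hf.2 K hK
    obtain ⟨D, hD⟩ := hg.2 K hK
    exact ⟨C + D, fun y hy ↦ (abs_add_le _ _).trans (add_le_add (hC y hy) (hD y hy))⟩
  | smul a f _ hf =>
    refine ⟨hf.1.const_smul a, fun K hK ↦ ?_⟩
    obtain ⟨C, hC⟩ := hf.2 K hK
    refine ⟨|a| * C, fun y hy ↦ ?_⟩
    rw [Pi.smul_apply, smul_eq_mul, abs_mul]
    exact mul_le_mul_of_nonneg_left (hC y hy) (abs_nonneg a)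

-- With `u = ℓ i (y - q) / ℓ i w`, the remaining steps are exactly those of the line `y - x • w`
-- taken at its `i`-th jump `x = u`. This identifies the terms of `jumpSum` as cone functions.
open Classical in
theorem coneFun_exchangeDual (p : E → ℝ) (ℓ : I → E →L[ℝ] ℝ) (w : E) (i : I)
    (q y : E) : coneFun p (exchangeDual ℓ w i) q y = p y * (step (ℓ i (y - q) / ℓ i w) *
      ∏ j ∈ Finset.univ.erase i, step (ℓ j (y - q) - ℓ j w * (ℓ i (y - q) / ℓ i w))) := by
  rw [coneFun, ← Finset.mul_prod_erase _ _ (Finset.mem_univ i)]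
  congr 2
  · simp [exchangeDual, div_eq_inv_mul]
  · refine Finset.prod_congr rfl fun j hj ↦ ?_
    congr 1
    simp only [exchangeDual, Function.update_of_ne (Finset.ne_of_mem_erase hj),
      _root_.sub_apply, _root_.smul_apply, smul_eq_mul]
    ring

/-- Weighted average of `f` along the segment from `y` to `y - w`. -/
def segmentConv (p : ℝ[X]) (w : E) (f : E → ℝ) (y : E) : ℝ :=
  ∫ x in (0 : ℝ)..1, p.eval x * f (y - x • w)

theorem IsTame.intervalIntegrable [MeasurableSpace E] [BorelSpace E] {f : E → ℝ} (hf : IsTame f)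
    (p : ℝ[X]) (w y : E) :
    IntervalIntegrable (fun x : ℝ ↦ p.eval x * f (y - x • w)) volume 0 1 := by
  have hc : Continuous fun x : ℝ ↦ y - x • w := by fun_prop
  obtain ⟨C, hC⟩ := hf.2 _ ((isCompact_Icc (a := (0 : ℝ)) (b := 1)).image hc)
  rw [intervalIntegrable_iff_integrableOn_Ioc_of_le zero_le_one]
  refine Integrable.mul_bdd (c := C) ?_ (hf.1.comp hc.measurable).aestronglyMeasurable ?_
  · exact (p.continuous.integrableOn_Icc).mono_set Ioc_subset_Icc_self
  · exact (ae_restrict_iff' measurableSet_Ioc).2 (ae_of_all _ fun x hx ↦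
      hC _ (mem_image_of_mem _ ⟨hx.1.le, hx.2⟩))

variable [MeasurableSpace E] [BorelSpace E] [FiniteDimensional ℝ E] (μ : Measure E)
  [μ.IsAddHaarMeasure]

theorem ae_apply_ne {L : E →L[ℝ] ℝ} (hL : L ≠ 0) (a : ℝ) : ∀ᵐ y ∂μ, L y ≠ a := by
  rw [ae_iff]
  simp only [not_not]
  by_cases h : ∃ y₀, L y₀ = a
  · obtain ⟨y₀, rfl⟩ := h
    have hker : μ (LinearMap.ker (L : E →ₗ[ℝ] ℝ) : Set E) = 0 := by
      refine Measure.addHaar_submodule μ _ fun h ↦ hL ?_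
      ext y
      have : y ∈ LinearMap.ker (L : E →ₗ[ℝ] ℝ) := h ▸ Submodule.mem_top
      simpa using this
    rw [← (measurePreserving_sub_right μ y₀).measure_preimage
      (L.isClosed_ker.measurableSet.nullMeasurableSet)] at hker
    convert hker using 2
    ext y
    simp [sub_eq_zero]
  · convert measure_empty (μ := μ)
    ext y
    simp only [mem_ofPred_eq, mem_empty_iff_false, iff_false]
    exact fun hy ↦ h ⟨y, hy⟩

/-- By Fubini, for almost every `y` the segment from `y` meets a given null set in a null set of
parameters. -/
theorem segmentConv_congr_ae {f g : E → ℝ} (hfg : f =ᵐ[μ] g) (p : ℝ[X]) (w : E) :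
    segmentConv p w f =ᵐ[μ] segmentConv p w g := by
  obtain ⟨N, hN, hNm, hN0⟩ := exists_measurable_superset_of_null (ae_iff.1 hfg)
  have h1 : ∀ x : ℝ, ∀ᵐ y ∂μ, y - x • w ∉ N := fun x ↦
    (measurePreserving_sub_right μ (x • w)).quasiMeasurePreserving.ae
      (measure_eq_zero_iff_ae_notMem.1 hN0)
  have hmeas : MeasurableSet {z : ℝ × E | z.2 - z.1 • w ∉ N} :=
    (measurableSet_preimage (by fun_prop) hNm).compl
  have h2 : ∀ᵐ y ∂μ, ∀ᵐ x : ℝ, y - x • w ∉ N :=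
    (Measure.ae_ae_comm (μ := (volume : Measure ℝ)) (ν := μ)
      (p := fun x y ↦ y - x • w ∉ N) hmeas).1 (ae_of_all _ h1)
  filter_upwards [h2] with y hy
  refine intervalIntegral.integral_congr_ae ?_
  filter_upwards [hy] with x hx _
  have : f (y - x • w) = g (y - x • w) := by
    by_contra h
    exact hx (hN h)
  rw [this]

/-- The integrand in `x` is a polynomial times steps. The endpoints `x = 1` and `x = 0` give cones
at `q + w` and `q`. A jump at `x = u` counts only if `0 < u < 1`, which gives the difference of the
exchanged cones at `q` and `q + w`. The formula needs distinct jumps away from the endpoints, hence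
holds almost everywhere. -/
theorem segmentConv_coneFun {e : I → E} {ℓ : I → E →L[ℝ] ℝ} (hd : IsDualSystem e ℓ)
    (hA : ∀ i, e i ∈ A) {q : E} (hq : q ∈ Λ) {p₀ : E → ℝ} (hp₀ : p₀ ∈ polyFun E) (p : ℝ[X])
    {w : E} (hwA : w ∈ A) (hwΛ : w ∈ Λ) :
    ∃ g ∈ coneSplines I A Λ, segmentConv p w (coneFun p₀ ℓ q) =ᵐ[μ] g := by
  classical
  obtain ⟨Q, hQ⟩ := exists_polynomial_along_line hp₀ w
  obtain ⟨R, hR⟩ := (p.map (algebraMap ℝ (polyFun E)) * Q).exists_derivative_eq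
  let Rf : E → ℝ → ℝ := fun y x ↦ (R.map (evalAt y)).eval x
  have hRd : ∀ y x, HasDerivAt (Rf y) (p.eval x * p₀ (y - x • w)) x := by
    intro y x
    have h := (R.map (evalAt y)).hasDerivAt x
    have hmap : (p.map (algebraMap ℝ (polyFun E))).map (evalAt y) = p := by
      rw [Polynomial.map_map]
      -- The composite of `algebraMap` with `evalAt y` is a ring endomorphism of `ℝ`, and the
      -- identity is the only one.
      exact (congrArg (fun φ ↦ p.map φ) (Subsingleton.elim _ (RingHom.id ℝ))).trans Polynomial.map_id
    rwa [derivative_map, hR, Polynomial.map_mul, eval_mul, ← hQ, hmap] at h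
  have hu : ∀ i, (fun y ↦ ℓ i (y - q) / ℓ i w) ∈ polyFun E := by
    intro i
    have := (polyFun E).mul_mem ((polyFun E).sub_mem (polyFun_clm (ℓ i))
      (polyFun_const (ℓ i q))) (polyFun_const (ℓ i w)⁻¹)
    convert this using 1
    ext y
    simp [div_eq_mul_inv]
  have hRmem : ∀ {u : E → ℝ}, u ∈ polyFun E → (fun y ↦ Rf y (u y)) ∈ polyFun E :=
    fun hu ↦ polyFun_eval_map R hu
  let g : E → ℝ := coneFun (fun y ↦ Rf y 1) ℓ (q + w) - coneFun (fun y ↦ Rf y 0) ℓ q +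
    ∑ i, if ℓ i w ≠ 0 then ((SignType.sign (ℓ i w) : ℤ) : ℝ) •
      (coneFun (fun y ↦ Rf y (ℓ i (y - q) / ℓ i w)) (exchangeDual ℓ w i) q -
        coneFun (fun y ↦ Rf y (ℓ i (y - q) / ℓ i w)) (exchangeDual ℓ w i) (q + w)) else 0
  refine ⟨g, ?_, ?_⟩
  · have hqw := Λ.add_mem hq hwΛ
    refine Submodule.add_mem _ (Submodule.sub_mem _ (coneFun_mem hd hA hqw
      (hRmem (polyFun_const 1))) (coneFun_mem hd hA hq (hRmem (polyFun_const 0))))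
      (Submodule.sum_mem _ fun i _ ↦ ?_)
    split_ifs with hi
    · have hA' : ∀ j, Function.update e i w j ∈ A := by
        intro j
        by_cases hj : j = i
        · subst hj; simpa using hwA
        · simpa [hj] using hA j
      exact Submodule.smul_mem _ _ (Submodule.sub_mem _
        (coneFun_mem (hd.exchange hi) hA' hq (hRmem (hu i)))
        (coneFun_mem (hd.exchange hi) hA' hqw (hRmem (hu i))))
    · exact Submodule.zero_mem _
  · have hne : ∀ᵐ y ∂μ, ∀ i, ℓ i w ≠ 0 → ℓ i (y - q) / ℓ i w ≠ 0 ∧ ℓ i (y - q) / ℓ i w ≠ 1 := by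
      refine ae_all_iff.2 fun i ↦ ?_
      by_cases hi : ℓ i w = 0
      · simp [hi]
      have hL : ℓ i ≠ 0 := fun h ↦ hi (by simp [h])
      filter_upwards [ae_apply_ne μ hL (ℓ i q), ae_apply_ne μ hL (ℓ i q + ℓ i w)] with y h0 h1 _
      rw [map_sub]
      refine ⟨div_ne_zero (sub_ne_zero.2 h0) hi, fun h ↦ h1 ?_⟩
      rw [div_eq_one_iff_eq hi] at h
      linarith
    have hinj : ∀ᵐ y ∂μ, ∀ i j, ℓ i w ≠ 0 → ℓ j w ≠ 0 →
        ℓ i (y - q) / ℓ i w = ℓ j (y - q) / ℓ j w → i = j := by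
      refine ae_all_iff.2 fun i ↦ ae_all_iff.2 fun j ↦ ?_
      by_cases hij : i = j
      · simp [hij]
      by_cases hi : ℓ i w = 0
      · simp [hi]
      -- Two jumps coincide only on a level set of this functional, which is nonzero because it
      -- takes the value `(ℓ i w)⁻¹` at `e i`.
      have hL : (ℓ i w)⁻¹ • ℓ i - (ℓ j w)⁻¹ • ℓ j ≠ 0 := by
        intro h
        have := DFunLike.congr_fun h (e i)
        simp [hd.1, hd.2 j i (Ne.symm hij), hi] at this
      filter_upwards [ae_apply_ne μ hL (((ℓ i w)⁻¹ • ℓ i - (ℓ j w)⁻¹ • ℓ j) q)] with y hy _ _ h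
      refine absurd ?_ hy
      simp only [_root_.sub_apply, _root_.smul_apply, smul_eq_mul,
        map_sub, div_eq_inv_mul, mul_sub] at h ⊢
      linarith
    filter_upwards [hne, hinj] with y hy hy'
    have hcont : Continuous fun x : ℝ ↦ p.eval x * p₀ (y - x • w) :=
      p.continuous.mul ((continuous_of_mem_polyFun hp₀).comp (by fun_prop))
    have := integral_mul_prod_step (hRd y) hcont (fun i ↦ ℓ i (y - q)) (fun i ↦ ℓ i w)
      Finset.univ (fun i _ j _ ↦ hy' i j) 0 1 zero_le_one (fun i _ ↦ hy i)
    have hl : segmentConv p w (coneFun p₀ ℓ q) y = ∫ x in (0 : ℝ)..1,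
        p.eval x * p₀ (y - x • w) * ∏ i, step (ℓ i (y - q) - ℓ i w * x) := by
      refine intervalIntegral.integral_congr fun x _ ↦ ?_
      simp only [coneFun]
      rw [← mul_assoc]
      congr 1
      refine Finset.prod_congr rfl fun i _ ↦ ?_
      congr 1
      simp only [map_sub, map_smul, smul_eq_mul]
      ring
    rw [hl, this, jumpSum]
    simp only [g, Pi.add_apply, Pi.sub_apply, Finset.sum_apply]
    congr 1
    · simp only [coneFun, mul_one, mul_zero, sub_zero, ← sub_sub, map_sub]
    · refine Finset.sum_congr rfl fun i _ ↦ ?_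
      by_cases hi : ℓ i w = 0
      · simp [hi]
      have hstep : step (ℓ i (y - q) / ℓ i w) - step (ℓ i (y - q) / ℓ i w - 1) =
          if 0 < ℓ i (y - q) / ℓ i w ∧ ℓ i (y - q) / ℓ i w < 1 then 1 else 0 := by
        obtain ⟨h0, h1⟩ := hy i hi
        generalize ℓ i (y - q) / ℓ i w = u at h0 h1
        clear_value g Rf
        clear hR hQ
        unfold step
        split_ifs <;> grind
      have hq1 : ℓ i (y - (q + w)) / ℓ i w = ℓ i (y - q) / ℓ i w - 1 := by
        rw [← sub_sub, map_sub _ _ w, sub_div, div_self hi]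
      -- Moving the apex by `w` changes only the `i`-th step, because the other exchanged
      -- functionals vanish on `w`.
      have hqj : ∀ j, ℓ j (y - (q + w)) - ℓ j w * (ℓ i (y - (q + w)) / ℓ i w) =
          ℓ j (y - q) - ℓ j w * (ℓ i (y - q) / ℓ i w) := by
        intro j
        rw [hq1, ← sub_sub, map_sub _ _ w]
        ring
      rw [if_pos hi, Pi.smul_apply, Pi.sub_apply, coneFun_exchangeDual, coneFun_exchangeDual]
      simp only [hqj, smul_eq_mul]
      rw [hq1]
      rw [← mul_sub, ← sub_mul, hstep]
      have hs : ((SignType.sign (ℓ i w) : ℤ) : ℝ) = (SignType.sign (ℓ i w) : ℝ) := by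
        rcases lt_or_gt_of_ne hi with h | h <;> simp [h]
      rw [hs]
      split_ifs with h1 h2 h3
      · ring
      · exact absurd h1.2 h2
      · exact absurd ⟨hi, h3⟩ h1
      · ring

theorem segmentConv_mem {f : E → ℝ} (hf : f ∈ coneSplines I A Λ) (p : ℝ[X]) {w : E}
    (hwA : w ∈ A) (hwΛ : w ∈ Λ) :
    ∃ g ∈ coneSplines I A Λ, segmentConv p w f =ᵐ[μ] g := by
  induction hf using Submodule.span_induction with
  | mem f hf =>
    obtain ⟨e, ℓ, hd, hA, q, hq, p₀, hp₀, rfl⟩ := hf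
    exact segmentConv_coneFun μ hd hA hq hp₀ p hwA hwΛ
  | zero => exact ⟨0, Submodule.zero_mem _, ae_of_all _ fun y ↦ by simp [segmentConv]⟩
  | add f g hf hg ihf ihg =>
    obtain ⟨f', hf', hff⟩ := ihf
    obtain ⟨g', hg', hgg⟩ := ihg
    refine ⟨f' + g', Submodule.add_mem _ hf' hg', ?_⟩
    filter_upwards [hff, hgg] with y hy hy'
    rw [Pi.add_apply, ← hy, ← hy', segmentConv, segmentConv, segmentConv,
      ← intervalIntegral.integral_add ((isTame_of_mem_coneSplines hf).intervalIntegrable p w y)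
      ((isTame_of_mem_coneSplines hg).intervalIntegrable p w y)]
    simp [mul_add]
  | smul a f hf ihf =>
    obtain ⟨f', hf', hff⟩ := ihf
    refine ⟨a • f', Submodule.smul_mem _ _ hf', ?_⟩
    filter_upwards [hff] with y hy
    rw [Pi.smul_apply, ← hy, segmentConv, segmentConv, smul_eq_mul,
      ← intervalIntegral.integral_const_mul]
    refine intervalIntegral.integral_congr fun x _ ↦ ?_
    simp only [Pi.smul_apply, smul_eq_mul]
    ring

end ConeSplines

/-! ### Averages over zonotopes as iterated segment averages. -/

section BoxConvolution

variable {E : Type*} [NormedAddCommGroup E] [NormedSpace ℝ E]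

/-- Weighted average of `f` over the translates of `y` by the points of a zonotope. -/
def boxConv {κ : Type*} [Fintype κ] (p : κ → ℝ[X]) (w : κ → E) (f : E → ℝ) (y : E) : ℝ :=
  ∫ x in univ.pi fun _ : κ ↦ Icc (0 : ℝ) 1,
    (∏ j, (p j).eval (x j)) * f (y - ∑ j, x j • w j)

theorem isCompact_cube (κ : Type*) : IsCompact (univ.pi fun _ : κ ↦ Icc (0 : ℝ) 1) :=
  isCompact_univ_pi fun _ ↦ isCompact_Icc

theorem measurableSet_cube (κ : Type*) [Fintype κ] :
    MeasurableSet (univ.pi fun _ : κ ↦ Icc (0 : ℝ) 1) :=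
  MeasurableSet.univ_pi fun _ ↦ measurableSet_Icc

theorem continuous_prod_eval {κ : Type*} [Fintype κ] (p : κ → ℝ[X]) :
    Continuous fun x : κ → ℝ ↦ ∏ j, (p j).eval (x j) :=
  continuous_finsetProd _ fun j _ ↦ (p j).continuous.comp (continuous_apply j)

theorem IsTame.integrableOn_cube [MeasurableSpace E] [BorelSpace E] {f : E → ℝ} (hf : IsTame f)
    {κ : Type*} [Fintype κ] (p : κ → ℝ[X]) (w : κ → E) (y : E) :
    IntegrableOn (fun x : κ → ℝ ↦ (∏ j, (p j).eval (x j)) * f (y - ∑ j, x j • w j))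
      (univ.pi fun _ ↦ Icc (0 : ℝ) 1) := by
  have hc : Continuous fun x : κ → ℝ ↦ y - ∑ j, x j • w j := by fun_prop
  obtain ⟨C, hC⟩ := hf.2 _ ((isCompact_cube κ).image hc)
  refine Integrable.mul_bdd (c := C) ?_ (hf.1.comp hc.measurable).aestronglyMeasurable ?_
  · exact (continuous_prod_eval p).continuousOn.integrableOn_compact (isCompact_cube κ)
  · exact (ae_restrict_iff' (measurableSet_cube κ)).2 (ae_of_all _ fun x hx ↦
      hC _ (mem_image_of_mem _ hx))

theorem boxConv_succ [MeasurableSpace E] [BorelSpace E] {f : E → ℝ} (hf : IsTame f) {n : ℕ}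
    (p : Fin (n + 1) → ℝ[X]) (w : Fin (n + 1) → E) :
    boxConv p w f = segmentConv (p 0) (w 0) (boxConv (p ∘ Fin.succ) (w ∘ Fin.succ) f) := by
  ext y
  have he := (volume_preserving_piFinSuccAbove (fun _ : Fin (n + 1) ↦ ℝ) 0).symm
  have hemb := (MeasurableEquiv.piFinSuccAbove (fun _ : Fin (n + 1) ↦ ℝ) 0).symm.measurableEmbedding
  have hpre : (MeasurableEquiv.piFinSuccAbove (fun _ : Fin (n + 1) ↦ ℝ) 0).symm ⁻¹'
      (univ.pi fun _ ↦ Icc (0 : ℝ) 1) = Icc (0 : ℝ) 1 ×ˢ univ.pi fun _ ↦ Icc (0 : ℝ) 1 := by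
    ext ⟨a, x⟩
    simp only [mem_preimage, mem_univ_pi, mem_prod, Fin.forall_fin_succ]
    rfl
  have hint := (he.integrableOn_comp_preimage hemb).2 (hf.integrableOn_cube p w y)
  rw [boxConv, ← he.setIntegral_preimage_emb hemb]
  rw [hpre] at hint ⊢
  simp only [Function.comp_def] at hint
  rw [Measure.volume_eq_prod] at hint ⊢
  rw [setIntegral_prod _ hint, segmentConv, intervalIntegral.integral_of_le zero_le_one,
    integral_Icc_eq_integral_Ioc]
  refine setIntegral_congr_fun measurableSet_Ioc fun a _ ↦ ?_
  simp only [boxConv]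
  rw [← integral_const_mul]
  refine setIntegral_congr_fun (measurableSet_cube _) fun x _ ↦ ?_
  simp only [Fin.prod_univ_succ, Fin.sum_univ_succ, ← sub_sub, mul_assoc]
  rfl

theorem boxConv_reindex {κ κ' : Type*} [Fintype κ] [Fintype κ'] (e : κ' ≃ κ) (p : κ → ℝ[X])
    (w : κ → E) (f : E → ℝ) : boxConv p w f = boxConv (p ∘ e) (w ∘ e) f := by
  ext y
  have he := volume_measurePreserving_piCongrLeft (fun _ : κ ↦ ℝ) e
  have hemb := (MeasurableEquiv.piCongrLeft (fun _ : κ ↦ ℝ) e).measurableEmbedding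
  have happ : ∀ (x : κ' → ℝ) j, MeasurableEquiv.piCongrLeft (fun _ : κ ↦ ℝ) e x (e j) = x j :=
    fun x j ↦ MeasurableEquiv.piCongrLeft_apply_apply (β := fun _ : κ ↦ ℝ) e x j
  have hpre : (MeasurableEquiv.piCongrLeft (fun _ : κ ↦ ℝ) e) ⁻¹'
      (univ.pi fun _ ↦ Icc (0 : ℝ) 1) = univ.pi fun _ ↦ Icc (0 : ℝ) 1 := by
    ext x
    simp only [mem_preimage, mem_univ_pi, ← e.forall_congr_right (q := fun j ↦
      MeasurableEquiv.piCongrLeft (fun _ : κ ↦ ℝ) e x j ∈ Icc (0 : ℝ) 1), happ]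
  rw [boxConv, ← he.setIntegral_preimage_emb hemb, hpre, boxConv]
  refine setIntegral_congr_fun (measurableSet_cube _) fun x _ ↦ ?_
  simp only [← e.prod_comp, ← e.sum_comp, happ, Function.comp_apply]

variable {I : Type*} [Fintype I] {A : Set E} {Λ : Submodule ℤ E} [MeasurableSpace E] [BorelSpace E]
  [FiniteDimensional ℝ E] (μ : Measure E) [μ.IsAddHaarMeasure]

theorem boxConv_mem {κ : Type*} [Fintype κ] {f : E → ℝ} (hf : f ∈ coneSplines I A Λ)
    (p : κ → ℝ[X]) {w : κ → E} (hA : ∀ j, w j ∈ A) (hΛ : ∀ j, w j ∈ Λ) :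
    ∃ g ∈ coneSplines I A Λ, boxConv p w f =ᵐ[μ] g := by
  suffices H : ∀ (n : ℕ) (p : Fin n → ℝ[X]) (w : Fin n → E), (∀ j, w j ∈ A) → (∀ j, w j ∈ Λ) →
      ∃ g ∈ coneSplines I A Λ, boxConv p w f =ᵐ[μ] g by
    rw [boxConv_reindex (Fintype.equivFin κ).symm]
    exact H _ _ _ (fun j ↦ hA _) (fun j ↦ hΛ _)
  intro n
  induction n with
  | zero =>
    intro p w _ _
    refine ⟨f, hf, ae_of_all _ fun y ↦ ?_⟩
    have : (univ.pi fun _ : Fin 0 ↦ Icc (0 : ℝ) 1) = univ := by ext; simp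
    simp [boxConv, this, Measure.real, volume_pi]
  | succ n ih =>
    intro p w hA hΛ
    obtain ⟨g, hg, hfg⟩ := ih (p ∘ Fin.succ) (w ∘ Fin.succ) (fun j ↦ hA _) (fun j ↦ hΛ _)
    obtain ⟨g', hg', hgg⟩ := segmentConv_mem μ hg (p 0) (hA 0) (hΛ 0)
    refine ⟨g', hg', ?_⟩
    rw [boxConv_succ (isTame_of_mem_coneSplines hf)]
    exact (segmentConv_congr_ae μ hfg _ _).trans hgg

end BoxConvolution

/-! ### Polynomials of fractional parts as cone splines on bounded regions. -/

section Periodic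

open Classical in
/-- On a bounded interval, a polynomial of the fractional part is a combination of polynomials
cut off at integers. -/
theorem exists_eval_fract_eq (B : ℝ[X]) (K : ℕ) : ∃ (S : Finset (ℤ × ℤ)) (D : ℤ × ℤ → ℝ[X]),
    ∀ t : ℝ, |t| < K → B.eval (Int.fract t) =
      ∑ m ∈ S, (D m).eval t * step (t - ((m.1 + m.2 : ℤ) : ℝ)) := by
  -- The pair `(m, 0)`, `(m, 1)` contributes `B (t - m)` times the indicator of `[m, m + 1)`, as a
  -- difference of two steps.
  refine ⟨Finset.Icc (-K : ℤ) K ×ˢ {0, 1},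
    fun m ↦ (if m.2 = 0 then 1 else -1) * B.comp (X - C (m.1 : ℝ)), fun t ht ↦ ?_⟩
  have hfl : ⌊t⌋ ∈ Finset.Icc (-K : ℤ) K := by
    rw [abs_lt] at ht
    rw [Finset.mem_Icc]
    refine ⟨Int.le_floor.2 (by push_cast; exact ht.1.le), ?_⟩
    exact_mod_cast (Int.floor_le t).trans ht.2.le
  rw [Finset.sum_product, Finset.sum_eq_single_of_mem _ hfl]
  · rw [Finset.sum_pair zero_ne_one, step_of_nonneg, step_of_neg]
    · rw [← Int.self_sub_floor]; simp
    · push_cast; linarith [Int.lt_floor_add_one t]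
    · push_cast; linarith [Int.floor_le t]
  · intro m _ hm
    rw [Finset.sum_pair zero_ne_one]
    have : step (t - ((m + 0 : ℤ) : ℝ)) = step (t - ((m + 1 : ℤ) : ℝ)) := by
      rcases hm.lt_or_gt with h | h
      · have h' : ((m + 1 : ℤ) : ℝ) ≤ ⌊t⌋ := by exact_mod_cast h
        have := Int.floor_le t
        push_cast at h' ⊢
        rw [step_of_nonneg (by linarith), step_of_nonneg (by linarith)]
      · have h' : ((⌊t⌋ + 1 : ℤ) : ℝ) ≤ m := by exact_mod_cast h
        have := Int.lt_floor_add_one t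
        push_cast at h' ⊢
        rw [step_of_neg (by linarith), step_of_neg (by linarith)]
    rw [this]; simp

variable {E : Type*} [NormedAddCommGroup E] [NormedSpace ℝ E] {I : Type*} [Fintype I]
  {A : Set E} {Λ : Submodule ℤ E}

open Classical in
/-- On a bounded region, a product of polynomials of the fractional parts of the coordinates is a
cone spline. -/
theorem exists_coneSpline_eq_prod_eval_fract {e : I → E} {ℓ : I → E →L[ℝ] ℝ}
    (hd : IsDualSystem e ℓ) (hA : ∀ i, e i ∈ A) (hΛ : ∀ i, e i ∈ Λ) (B : I → ℝ[X]) (K : ℕ) :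
    ∃ f ∈ coneSplines I A Λ, ∀ y, (∀ i, |ℓ i y| < K) →
      ∏ i, (B i).eval (Int.fract (ℓ i y)) = f y := by
  choose S D hSD using fun i ↦ exists_eval_fract_eq (B i) K
  refine ⟨∑ m ∈ Fintype.piFinset S, coneFun (∏ i, fun y ↦ (D i (m i)).eval (ℓ i y)) ℓ
    (∑ i, ((m i).1 + (m i).2) • e i), ?_, fun y hy ↦ ?_⟩
  · refine Submodule.sum_mem _ fun m _ ↦ coneFun_mem hd hA
      (Λ.sum_mem fun i _ ↦ Λ.smul_mem _ (hΛ i)) ?_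
    exact (polyFun E).prod_mem fun i _ ↦ polyFun_eval (polyFun_clm _) _
  · rw [Finset.prod_congr rfl fun i _ ↦ hSD i _ (hy i), Finset.prod_univ_sum, Finset.sum_apply]
    refine Finset.sum_congr rfl fun m _ ↦ ?_
    rw [coneFun, Finset.prod_mul_distrib, Finset.prod_apply]
    congr 1
    refine Finset.prod_congr rfl fun i _ ↦ ?_
    congr 1
    rw [map_sub, map_sum, Finset.sum_eq_single_of_mem i (Finset.mem_univ i)]
    · rw [map_zsmul, hd.1]; simp
    · intro j _ hj
      rw [map_zsmul, hd.2 i j hj.symm, smul_zero]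

end Periodic

/-! ### Polynomiality off the walls. -/

section LocallyPolynomial

variable {E : Type*} [NormedAddCommGroup E] [NormedSpace ℝ E] {I : Type*} [Fintype I]
  {A : Set E} {Λ : Submodule ℤ E}

variable (I A Λ) in
/-- The union of the walls of the cones with edges in `A` and apex in `Λ`. -/
def coneWalls : Set E :=
  {y | ∃ (e : I → E) (ℓ : I → E →L[ℝ] ℝ), IsDualSystem e ℓ ∧ (∀ i, e i ∈ A) ∧
    ∃ q ∈ Λ, ∃ i, ℓ i (y - q) = 0}

theorem exists_eventuallyEq_polyFun {f : E → ℝ} (hf : f ∈ coneSplines I A Λ) {y₀ : E}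
    (hy₀ : y₀ ∉ coneWalls I A Λ) : ∃ p ∈ polyFun E, f =ᶠ[𝓝 y₀] p := by
  induction hf using Submodule.span_induction with
  | mem f hf =>
    obtain ⟨e, ℓ, hd, hA, q, hq, p, hp, rfl⟩ := hf
    refine ⟨_, (polyFun E).mul_mem hp (polyFun_const (∏ i, step (ℓ i (y₀ - q)))), ?_⟩
    have : ∀ᶠ y in 𝓝 y₀, ∀ i, step (ℓ i (y - q)) = step (ℓ i (y₀ - q)) := by
      refine eventually_all.2 fun i ↦ ?_
      have hc : ContinuousAt (fun y ↦ ℓ i (y - q)) y₀ := by fun_prop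
      exact hc.eventually (eventually_step_eq fun h ↦ hy₀ ⟨e, ℓ, hd, hA, q, hq, i, h⟩)
    filter_upwards [this] with y hy
    simp only [coneFun, hy, Pi.mul_apply]
  | zero => exact ⟨0, (polyFun E).zero_mem, EventuallyEq.rfl⟩
  | add f g _ _ hf hg =>
    obtain ⟨p, hp, hfp⟩ := hf
    obtain ⟨r, hr, hgr⟩ := hg
    exact ⟨p + r, (polyFun E).add_mem hp hr, hfp.add hgr⟩
  | smul a f _ hf =>
    obtain ⟨p, hp, hfp⟩ := hf
    exact ⟨a • p, (polyFun E).smul_mem hp a, hfp.const_smul a⟩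

/-- The product of polynomials of the fractional parts of the coordinates. -/
def prodFract (B : I → ℝ[X]) (ℓ : I → E →L[ℝ] ℝ) (y : E) : ℝ :=
  ∏ i, (B i).eval (Int.fract (ℓ i y))

theorem exists_abs_prodFract_le (B : I → ℝ[X]) (ℓ : I → E →L[ℝ] ℝ) :
    ∃ C, ∀ y, |prodFract B ℓ y| ≤ C := by
  choose C hC using fun i ↦ (isCompact_Icc (a := (0 : ℝ)) (b := 1)).exists_bound_of_continuousOn
    (B i).continuous.continuousOn
  refine ⟨∏ i, C i, fun y ↦ ?_⟩
  rw [prodFract, Finset.abs_prod]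
  exact Finset.prod_le_prod (fun _ _ ↦ abs_nonneg _) fun i _ ↦
    hC i _ ⟨Int.fract_nonneg _, (Int.fract_lt_one _).le⟩

theorem measurable_prodFract [MeasurableSpace E] [BorelSpace E] (B : I → ℝ[X])
    (ℓ : I → E →L[ℝ] ℝ) : Measurable (prodFract B ℓ) :=
  Finset.measurable_fun_prod _ fun i _ ↦
    (B i).continuous.measurable.comp (measurable_fract.comp (ℓ i).measurable)

theorem continuousAt_prodFract (B : I → ℝ[X]) (ℓ : I → E →L[ℝ] ℝ) {y : E}
    (hy : ∀ i, ∀ n : ℤ, ℓ i y ≠ n) : ContinuousAt (prodFract B ℓ) y :=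
  tendsto_finsetProd _ fun i _ ↦ (B i).continuous.continuousAt.comp
    ((continuousAt_fract (hy i _)).comp (ℓ i).continuous.continuousAt)

theorem prodFract_add {e : I → E} {ℓ : I → E →L[ℝ] ℝ} (hd : IsDualSystem e ℓ) (B : I → ℝ[X])
    (y : E) (i : I) : prodFract B ℓ (y + e i) = prodFract B ℓ y := by
  refine Finset.prod_congr rfl fun j _ ↦ ?_
  congr 1
  by_cases hj : j = i
  · rw [hj, map_add, hd.1, Int.fract_add_one]
  · rw [map_add, hd.2 j i hj, add_zero]

variable {κ : Type*} [Fintype κ]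

theorem boxConv_prodFract_add {e : I → E} {ℓ : I → E →L[ℝ] ℝ} (hd : IsDualSystem e ℓ)
    (B : I → ℝ[X]) (p : κ → ℝ[X]) (w : κ → E) (y : E) (i : I) :
    boxConv p w (prodFract B ℓ) (y + e i) = boxConv p w (prodFract B ℓ) y := by
  simp only [boxConv, add_sub_right_comm, prodFract_add hd]

variable [MeasurableSpace E] [BorelSpace E]

/-- Dominated convergence. If some `w j` moves the coordinate `ℓ i`, that coordinate of the
translate is an integer only for a null set of `x`. Otherwise it does not depend on `x`, and the
hypothesis keeps it off the integers. -/
theorem continuousAt_boxConv_prodFract (B : I → ℝ[X]) (ℓ : I → E →L[ℝ] ℝ) (p : κ → ℝ[X])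
    (w : κ → E) {y₀ : E} (hy₀ : ∀ i, (∀ j, ℓ i (w j) = 0) → ∀ n : ℤ, ℓ i y₀ ≠ n) :
    ContinuousAt (boxConv p w (prodFract B ℓ)) y₀ := by
  classical
  obtain ⟨C, hC⟩ := exists_abs_prodFract_le B ℓ
  have hmeas : ∀ y, AEStronglyMeasurable
      (fun x : κ → ℝ ↦ (∏ j, (p j).eval (x j)) * prodFract B ℓ (y - ∑ j, x j • w j))
      (volume.restrict (univ.pi fun _ ↦ Icc (0 : ℝ) 1)) := by
    intro y
    have hc : Continuous fun x : κ → ℝ ↦ y - ∑ j, x j • w j := by fun_prop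
    exact ((continuous_prod_eval p).measurable.mul
      ((measurable_prodFract B ℓ).comp hc.measurable)).aestronglyMeasurable
  refine continuousAt_of_dominated (bound := fun x ↦ |∏ j, (p j).eval (x j)| * C)
    (Eventually.of_forall hmeas) (Eventually.of_forall fun y ↦ ae_of_all _ fun x ↦ ?_) ?_ ?_
  · rw [Real.norm_eq_abs, abs_mul]
    exact mul_le_mul_of_nonneg_left (hC _) (abs_nonneg _)
  · exact ((continuous_prod_eval p).abs.mul continuous_const).continuousOn.integrableOn_compact
      (isCompact_cube κ)
  · have hne : ∀ᵐ x : κ → ℝ, ∀ i, ∀ n : ℤ, ℓ i (y₀ - ∑ j, x j • w j) ≠ n := by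
      refine ae_all_iff.2 fun i ↦ ae_all_iff.2 fun n ↦ ?_
      by_cases hi : ∀ j, ℓ i (w j) = 0
      · refine ae_of_all _ fun x ↦ ?_
        simpa [hi] using hy₀ i hi n
      · push Not at hi
        obtain ⟨j, hj⟩ := hi
        let L : (κ → ℝ) →L[ℝ] ℝ :=
          (ℓ i).comp (∑ j, (ContinuousLinearMap.proj j : (κ → ℝ) →L[ℝ] ℝ).smulRight (w j))
        have hLx : ∀ x, L x = ℓ i (∑ j, x j • w j) := by simp [L]
        have hL : L ≠ 0 := by
          intro h
          apply hj
          have := hLx (Pi.single j 1)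
          rw [h] at this
          simpa [Pi.single_apply] using this.symm
        filter_upwards [ae_apply_ne volume hL (ℓ i y₀ - n)] with x hx h
        rw [hLx] at hx
        rw [map_sub] at h
        exact hx (by linarith)
    filter_upwards [ae_restrict_of_ae hne] with x hx
    refine continuousAt_const.mul ?_
    exact ContinuousAt.comp (f := fun y ↦ y - ∑ j, x j • w j)
      (continuousAt_prodFract B ℓ hx) (by fun_prop)

variable [FiniteDimensional ℝ E]

/-- The average of `prodFract` over the translates of a zonotope is polynomial near every point
which is not on a wall. -/
theorem exists_boxConv_prodFract_eventuallyEq (μ : Measure E) [μ.IsAddHaarMeasure] {e : I → E}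
    {ℓ : I → E →L[ℝ] ℝ} (hd : IsDualSystem e ℓ) (heA : ∀ i, e i ∈ A) (heΛ : ∀ i, e i ∈ Λ)
    (B : I → ℝ[X]) (p : κ → ℝ[X]) {w : κ → E} (hwA : ∀ j, w j ∈ A) (hwΛ : ∀ j, w j ∈ Λ) {y₀ : E}
    (hy₀ : y₀ ∉ coneWalls I A Λ) :
    ∃ r ∈ polyFun E, boxConv p w (prodFract B ℓ) =ᶠ[𝓝 y₀] r := by
  have hc : Continuous fun z : E × (κ → ℝ) ↦ fun i ↦ ℓ i (z.1 - ∑ j, z.2 j • w j) := by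
    fun_prop
  obtain ⟨C, hC⟩ := ((isCompact_closedBall y₀ 1).prod
    (isCompact_cube κ)).exists_bound_of_continuousOn hc.continuousOn
  -- `K` bounds all coordinates of all translates of points of the unit ball around `y₀`, so a
  -- single spline represents the integrand there.
  obtain ⟨K, hK⟩ := exists_nat_gt C
  obtain ⟨f, hf, hfeq⟩ := exists_coneSpline_eq_prod_eval_fract hd heA heΛ B K
  have hloc : ∀ y ∈ Metric.ball y₀ 1, boxConv p w (prodFract B ℓ) y = boxConv p w f y := by
    intro y hy
    refine setIntegral_congr_fun (measurableSet_cube _) fun x hx ↦ ?_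
    have h := hC (y, x) ⟨Metric.ball_subset_closedBall hy, hx⟩
    rw [← hfeq _ fun i ↦ ((norm_le_pi_norm _ i).trans h).trans_lt hK]
    rfl
  obtain ⟨g, hg, hfg⟩ := boxConv_mem μ hf p hwA hwΛ
  obtain ⟨r, hr, hgr⟩ := exists_eventuallyEq_polyFun hg hy₀
  refine ⟨r, hr, ?_⟩
  have hU : ∀ᶠ y in 𝓝 y₀, ∀ i, (∀ j, ℓ i (w j) = 0) → ∀ n : ℤ, ℓ i y ≠ n := by
    refine eventually_all.2 fun i ↦ eventually_imp_distrib_left.2 fun _ ↦ ?_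
    have hopen : IsOpen (ℓ i ⁻¹' (range ((↑) : ℤ → ℝ))ᶜ) :=
      (Int.isClosedEmbedding_coe_real.isClosed_range.isOpen_compl).preimage (ℓ i).continuous
    have hmem : y₀ ∈ ℓ i ⁻¹' (range ((↑) : ℤ → ℝ))ᶜ := by
      rintro ⟨n, hn⟩
      -- If `ℓ i y₀ = n`, then `y₀` lies on a wall of the cone with apex `n • e i`.
      refine hy₀ ⟨e, ℓ, hd, heA, n • e i, Λ.smul_mem _ (heΛ i), i, ?_⟩
      rw [map_sub, map_zsmul, hd.1, ← hn]
      simp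
    filter_upwards [hopen.mem_nhds hmem] with y hy n hn
    exact hy ⟨n, hn.symm⟩
  obtain ⟨W, hWsub, hWo, hyW⟩ := mem_nhds_iff.1
    (inter_mem (inter_mem hU hgr) (Metric.ball_mem_nhds y₀ one_pos))
  have hae : boxConv p w (prodFract B ℓ) =ᵐ[μ.restrict W] r := by
    filter_upwards [ae_restrict_of_ae hfg, ae_restrict_mem hWo.measurableSet] with y hy hyW
    rw [hloc y (hWsub hyW).2, hy]
    exact (hWsub hyW).1.2
  -- Continuity of both sides on the open set `W` turns almost everywhere equality into equality.
  have heq := Measure.eqOn_open_of_ae_eq hae hWo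
    (fun y hy ↦ (continuousAt_boxConv_prodFract B ℓ p w (hWsub hy).1.1).continuousWithinAt)
    (continuous_of_mem_polyFun hr).continuousOn
  filter_upwards [hWo.mem_nhds hyW] with y hy using heq hy

end LocallyPolynomial

/-! ### Application to the root system and its coroot lattice. -/

section RootSystem

variable {ι V : Type*} [NormedAddCommGroup V] [InnerProductSpace ℝ V]
  {P : RootPairing ι ℝ V V}

/-- A polynomial function which is periodic with respect to the simple coroots is constant. -/
theorem eq_apply_zero_of_periodic [P.IsRootSystem] (b : P.Base) {r : V → ℝ} (hr : r ∈ polyFun V)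
    (hper : ∀ (i : b.support) y, r (y + P.coroot i) = r y) (y : V) : r y = r 0 := by
  have h : ∀ z, r (z + ∑ i, b.toCoweightBasis.repr y i • b.toCoweightBasis i) = r z := by
    refine Finset.sum_induction _ (fun v ↦ ∀ z, r (z + v) = r z) (fun u v hu hv z ↦ ?_)
      (fun z ↦ by rw [add_zero]) fun i _ z ↦ ?_
    · rw [← add_assoc, hv, hu]
    · rw [b.toCoweightBasis_apply]
      exact constant_along_period hr (hper i) z _
  simpa only [b.toCoweightBasis.sum_repr y, zero_add] using h 0

variable [FiniteDimensional ℝ V]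

/-- The hyperplanes are countably many null sets: `r - 1` vectors cannot span `V`, and `Q^∨` is
countable. -/
theorem exists_notMem_singularHyperplanes [Finite ι] (b : P.Base) :
    ∃ y, y ∉ singularHyperplanes b := by
  classical
  let : MeasurableSpace V := borel V
  have : BorelSpace V := ⟨rfl⟩
  have : Countable (corootLattice b) := by
    rw [corootLattice, ← Subtype.range_coe (s := P.coroot '' b.support)]
    infer_instance
  have h : ∀ᵐ y : V, ∀ (R : Finset ι) (q : corootLattice b), R.card + 1 = Module.finrank ℝ V →
      y - q ∉ Submodule.span ℝ (P.coroot '' (R : Set ι)) := by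
    refine ae_all_iff.2 fun R ↦ ae_all_iff.2 fun q ↦ ?_
    by_cases hR : R.card + 1 = Module.finrank ℝ V
    · have hne : Submodule.span ℝ (P.coroot '' (R : Set ι)) ≠ ⊤ := by
        intro htop
        have hle := finrank_span_finset_le_card (R := ℝ) (R.image P.coroot)
        rw [Finset.coe_image, Set.finrank, htop, finrank_top] at hle
        have := Finset.card_image_le (s := R) (f := P.coroot)
        omega
      have h0 := Measure.addHaar_submodule (volume : Measure V) _ hne
      filter_upwards [(measurePreserving_sub_right volume (q : V)).quasiMeasurePreserving.ae
        (measure_eq_zero_iff_ae_notMem.1 h0)] with y hy _ using hy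
    · exact ae_of_all _ fun y h ↦ absurd h hR
  obtain ⟨y, hy⟩ := h.exists
  exact ⟨y, fun ⟨R, hR, _, q, hq, hm⟩ ↦ hy R ⟨q, hq⟩ hR hm⟩

variable [P.IsRootSystem]

/-- The coordinates with respect to the simple coroots. -/
def coweightCoord (b : P.Base) (i : b.support) : V →L[ℝ] ℝ :=
  LinearMap.toContinuousLinearMap (b.toCoweightBasis.coord i)

theorem inner_fundamentalWeight (b : P.Base) (i : b.support) (y : V) :
    inner ℝ y (fundamentalWeight b i) = coweightCoord b i y := by
  rw [real_inner_comm, fundamentalWeight, InnerProductSpace.toDual_symm_apply]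
  rfl

theorem isDualSystem_coweightCoord (b : P.Base) :
    IsDualSystem (fun i : b.support ↦ P.coroot i) (coweightCoord b) := by
  refine ⟨fun i ↦ ?_, fun i j hij ↦ ?_⟩
  · simp [coweightCoord]
  · simp [coweightCoord, hij.symm]

/-- The Bernoulli polynomial with real coefficients. -/
def realBernoulli (k : ℕ) : ℝ[X] := (Polynomial.bernoulli k).map (algebraMap ℚ ℝ)

theorem bernoulliPeriodic_eq_boxConv [Fintype ι] (b : P.Base) [Fintype (NonSimplePosRoot b)]
    (k : PosRoot b → ℕ) :
    bernoulliPeriodic b k =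
      boxConv (fun α : NonSimplePosRoot b ↦ realBernoulli (k ⟨α.1, α.2.1⟩))
        (fun α ↦ P.coroot α.1) (prodFract (fun i : b.support ↦
          realBernoulli (k ⟨i.1, RootPairing.Base.isPos_of_mem_support i.2⟩)) (coweightCoord b)) := by
  ext y
  simp only [bernoulliPeriodic, boxConv, prodFract, bernoulliFun, realBernoulli,
    inner_fundamentalWeight, map_sub, map_sum, map_smul, smul_eq_mul]
  congr!

/-- A dual system indexed by the simple roots is a basis. Vanishing of the `i`-th coordinate of `y -
q` places it in the span of the other `r - 1` coroots, whose roots are also independent. -/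
theorem coneWalls_subset_singularHyperplanes [Fintype ι] (b : P.Base) :
    coneWalls b.support (range P.coroot) (corootLattice b) ⊆ singularHyperplanes b := by
  classical
  rintro y ⟨e, ℓ, hd, hA, q, hq, i, hi⟩
  choose a ha using hA
  have hcard : Fintype.card b.support = Module.finrank ℝ V :=
    (Module.finrank_eq_card_basis b.toCoweightBasis).symm
  have hli : LinearIndependent ℝ e := by
    refine Fintype.linearIndependent_iff.2 fun g hg j ↦ ?_
    have := congrArg (ℓ j) hg
    rw [map_sum, Finset.sum_eq_single_of_mem j (Finset.mem_univ j)] at this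
    · simpa [hd.1] using this
    · intro k _ hk
      simp [hd.2 j k hk.symm]
  have hae : P.coroot ∘ a = e := funext ha
  have hinj : Function.Injective a := by
    refine Function.Injective.of_comp (f := P.coroot) ?_
    rw [hae]
    exact hli.injective
  refine ⟨(Finset.univ.erase i).image a, ?_, ?_, q, hq, ?_⟩
  · rw [Finset.card_image_of_injective _ hinj, Finset.card_erase_add_one (Finset.mem_univ i),
      Finset.card_univ, hcard]
  · rw [← RootPairing.linearIndepOn_coroot_iff]
    refine LinearIndepOn.mono (s := range a) ?_ ?_
    · rw [← hae] at hli
      exact (linearIndepOn_range_iff hinj _).2 hli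
    · rw [Finset.coe_image]
      exact image_subset_range _ _
  · have hsp : y - q ∈ Submodule.span ℝ (range e) := by
      rw [hli.span_eq_top_of_card_eq_finrank' hcard]
      trivial
    obtain ⟨c, hc⟩ := (Submodule.mem_span_range_iff_exists_fun ℝ).1 hsp
    have hci : c i = 0 := by
      rw [← hc, map_sum, Finset.sum_eq_single_of_mem i (Finset.mem_univ i)] at hi
      · simpa [hd.1] using hi
      · intro k _ hk
        simp [hd.2 i k hk.symm]
    rw [← hc]
    refine Submodule.sum_mem _ fun j _ ↦ ?_
    by_cases hj : j = i
    · rw [hj, hci, zero_smul]; exact Submodule.zero_mem _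
    · refine Submodule.smul_mem _ _ (Submodule.subset_span ⟨a j, ?_, ha j⟩)
      exact Finset.mem_coe.2 (Finset.mem_image_of_mem _ (Finset.mem_erase.2 ⟨hj, Finset.mem_univ j⟩))

theorem exists_eventuallyEq_polyFun_of_notMem [Fintype ι] (b : P.Base) (k : PosRoot b → ℕ) {y₀ : V}
    (hy₀ : y₀ ∉ singularHyperplanes b) :
    ∃ r ∈ polyFun V, bernoulliPeriodic b k =ᶠ[𝓝 y₀] r := by
  let : MeasurableSpace V := borel V
  have : BorelSpace V := ⟨rfl⟩
  have hmem : ∀ i, P.coroot i ∈ corootLattice b := fun i ↦ b.coroot_mem_span_int i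
  have := Fintype.ofFinite (NonSimplePosRoot b)
  rw [bernoulliPeriodic_eq_boxConv]
  exact exists_boxConv_prodFract_eventuallyEq (A := range P.coroot) (Λ := corootLattice b) volume
    (isDualSystem_coweightCoord b) (fun i ↦ mem_range_self _) (fun i ↦ hmem _) _ _
    (fun j ↦ mem_range_self _) (fun j ↦ hmem _)
    (fun h ↦ hy₀ (coneWalls_subset_singularHyperplanes b h))

theorem bernoulliPeriodic_add_coroot [Fintype ι] (b : P.Base) (k : PosRoot b → ℕ) (y : V)
    (i : b.support) : bernoulliPeriodic b k (y + P.coroot i) = bernoulliPeriodic b k y := by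
  have := Fintype.ofFinite (NonSimplePosRoot b)
  rw [bernoulliPeriodic_eq_boxConv]
  exact boxConv_prodFract_add (isDualSystem_coweightCoord b) _ _ _ y i

/-- If `P(k, ·; Δ)` is analytic at all points of the singular hyperplanes, it is constant. -/
theorem eq_const_of_analyticAt [Fintype ι] (b : P.Base) (k : PosRoot b → ℕ)
    (h : ∀ y ∈ singularHyperplanes b, AnalyticAt ℝ (bernoulliPeriodic b k) y) :
    ∃ c : ℝ, ∀ y : V, bernoulliPeriodic b k y = c := by
  have han : AnalyticOnNhd ℝ (bernoulliPeriodic b k) univ := by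
    intro y _
    by_cases hy : y ∈ singularHyperplanes b
    · exact h y hy
    · obtain ⟨r, hr, heq⟩ := exists_eventuallyEq_polyFun_of_notMem b k hy
      exact (analyticAt_of_mem_polyFun hr y).congr heq.symm
  obtain ⟨y₀, hy₀⟩ := exists_notMem_singularHyperplanes b
  obtain ⟨r, hr, heq⟩ := exists_eventuallyEq_polyFun_of_notMem b k hy₀
  -- Identity theorem on the connected space `V`: the local polynomial at one regular point is
  -- global.
  have hrP : bernoulliPeriodic b k = r :=
    han.eq_of_eventuallyEq (fun y _ ↦ analyticAt_of_mem_polyFun hr y) heq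
  refine ⟨r 0, fun y ↦ ?_⟩
  rw [hrP]
  refine eq_apply_zero_of_periodic b hr (fun i z ↦ ?_) y
  rw [← hrP]
  exact bernoulliPeriodic_add_coroot b k z i

end RootSystem

end RootBernoulli

end

theorem mainTheorem11 {ι V : Type*} [Fintype ι]
    [NormedAddCommGroup V] [InnerProductSpace ℝ V] [FiniteDimensional ℝ V]
    (P : RootPairing ι ℝ V V) [P.IsRootSystem] [P.IsCrystallographic] [P.IsReduced]
    (hpairing : ∀ u v : V, P.toLinearMap u v = inner ℝ u v)
    (hcoroot : ∀ i, P.coroot i = (2 / inner ℝ (P.root i) (P.root i)) • P.root i)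
    (b : P.Base) (k : RootBernoulli.PosRoot b → ℕ)
    (hconst : ¬ ∃ c : ℝ, ∀ y : V, RootBernoulli.bernoulliPeriodic b k y = c) :
    ¬ AnalyticOnNhd ℝ (RootBernoulli.bernoulliPeriodic b k) Set.univ ∧
      ∃ y ∈ RootBernoulli.singularHyperplanes b,
        ¬ AnalyticAt ℝ (RootBernoulli.bernoulliPeriodic b k) y := by
  have h : ∃ y ∈ RootBernoulli.singularHyperplanes b,
      ¬ AnalyticAt ℝ (RootBernoulli.bernoulliPeriodic b k) y := by
    by_contra! hc
    exact hconst (RootBernoulli.eq_const_of_analyticAt b k hc)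
  refine ⟨fun han ↦ ?_, h⟩
  obtain ⟨y, -, hy⟩ := h
  exact hy (han y (Set.mem_univ y))
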